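/- A Polish group $G$ is called CLI if it admits a compatible complete left-invariant metric. A Polish $G$-space is a Polish space $X$ with a continuous action of a Polish group $G$. For $x,y\in X$, consider the following game $\mathrm{Emb}(x,y)$. Put $V_0=G$. In turn $n=1,2,\dots$, Player I plays an open neighborhood $U_n$ of $x$ in $X$ and an open neighborhood $V_n$ of the identity of $G$, and Player II replies with an element $g_{n-1}\in V_{n-1}$. Player II wins if $g_{n-1}\cdots g_1g_0\,y\in U_n$ for every $n\ge 1$. We say that $x$ is Becker embeddable into $y$ if Player II has a winning strategy in $\mathrm{Emb}(x,y)$. For equivalence relations $E,F$ on Polish spaces $A,B$, $E$ is Borel reducible to $F$ if there is a Borel map $f:A\to B$ such that $a\,E\,a'$ if and only if $f(a)\,F\,f(a')$, for all $a,a'\in A$. Theorem. Let $G$ be a Polish group and let $X$ be a Polish $G$-space. Suppose that every $G$-invariant dense $G_\delta$ subset $C$ of $X$ contains points $x,y$ with different $G$-orbits such that $x$ is Becker embeddable into $y$. Then for every $G$-invariant dense $G_\delta$ subset $C$ of $X$, the restriction to $C$ of the orbit equivalence relation of the action of $G$ on $X$ is not Borel reducible to the orbit equivalence relation of any continuous action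 of any CLI group on a Polish space. -/

import Mathlib

universe u v w z

namespace BeckerGame

open TopologicalSpace

/-- A move of Player I in the game `Emb(x, y)`: an open neighborhood `U` of `x` in `X` and an open
neighborhood `V` of the identity in `G`. -/
structure MoveI (G : Type*) {X : Type*} [Group G] [TopologicalSpace G] [TopologicalSpace X]
    (x : X) where
  U : OpenNhdsOf x
  V : OpenNhdsOf (1 : G)

/-- The product `g (n - 1) * ⋯ * g 1 * g 0`. -/
def leftProd {G : Type*} [Group G] (g : ℕ → G) : ℕ → G
  | 0 => 1
  | n + 1 => g n * leftProd g n

/-- A strategy for Player II: a reply to every nonempty finite sequence of moves of Player I.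
`σ n p` is the reply `g_n`, given in turn `n + 1`, when `p 0, …, p n` are the
moves `(U_1, V_1), …, (U_{n+1}, V_{n+1})` of Player I so far. -/
def StrategyII (G : Type*) {X : Type*} [Group G] [TopologicalSpace G] [TopologicalSpace X]
    (x : X) : Type _ :=
  (n : ℕ) → (Fin (n + 1) → MoveI G x) → G

section

variable {G : Type*} {X : Type*} [Group G] [TopologicalSpace G] [TopologicalSpace X]

/-- The elements `g_0, g_1, …` played by Player II when following `σ` against the sequence of
moves `m 0 = (U_1, V_1), m 1 = (U_2, V_2), …` of Player I. -/
def StrategyII.play {x : X} (σ : StrategyII G x) (m : ℕ → MoveI G x) (n : ℕ) : G :=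
  σ n (fun i => m i)

/-- In the run in which Player I plays `m 0 = (U_1, V_1), m 1 = (U_2, V_2), …` and Player II
plays `g_0, g_1, …`, Player II respects the rules (`g_n ∈ V_n` for every `n`, where `V_0 = G`)
and wins (`g_{n-1} ⋯ g_0 y ∈ U_n` for every `n > 0`). -/
def PlayerIIWins [MulAction G X] {x : X} (y : X) (m : ℕ → MoveI G x) (g : ℕ → G) : Prop :=
  (∀ n, g (n + 1) ∈ (m n).V) ∧ (∀ n, leftProd g (n + 1) • y ∈ (m n).U)

/-- `x` is Becker embeddable into `y`: Player II has a winning strategy in `Emb(x, y)`. -/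
def BeckerEmbeddable (G : Type*) {X : Type*} [Group G] [TopologicalSpace G] [TopologicalSpace X]
    [MulAction G X] (x y : X) : Prop :=
  ∃ σ : StrategyII G x, ∀ m : ℕ → MoveI G x, PlayerIIWins y m (σ.play m)

end

/-- A CLI group: a Polish group with a compatible complete left-invariant metric. -/
structure IsCLIGroup (H : Type*) [Group H] [t : TopologicalSpace H] : Prop where
  isTopologicalGroup : IsTopologicalGroup H
  polishSpace : PolishSpace H
  exists_metric : ∃ d : MetricSpace H,
    d.toUniformSpace.toTopologicalSpace = t ∧ @CompleteSpace H d.toUniformSpace ∧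
      ∀ g a b : H, d.dist (g * a) (g * b) = d.dist a b

/-- `E` is Borel reducible to `F`. -/
def BorelReducible {X Y : Type*} [TopologicalSpace X] [TopologicalSpace Y]
    (E : Setoid X) (F : Setoid Y) : Prop :=
  ∃ f : X → Y, @Measurable X Y (borel X) (borel Y) f ∧ ∀ a b : X, E a b ↔ F (f a) (f b)

/-- `E` is Borel reducible to the orbit equivalence relation of a continuous action of a CLI
group `H` on a Polish space `Y`. -/
def CLIClassifiable {X : Type u} [TopologicalSpace X] (E : Setoid X) : Prop :=
  ∃ (H : Type v) (Y : Type w) (_ : Group H) (_ : TopologicalSpace H) (_ : TopologicalSpace Y)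
    (_ : MulAction H Y),
    IsCLIGroup H ∧ PolishSpace Y ∧ ContinuousSMul H Y ∧
      BorelReducible E (MulAction.orbitRel H Y)

/-- The orbit equivalence relation of `G` acting on `X`, restricted to `C ⊆ X`. -/
def orbitRelOn (G : Type*) {X : Type*} [Group G] [MulAction G X] (C : Set X) : Setoid C :=
  (MulAction.orbitRel G X).comap Subtype.val

/-- `C` is a `G`-invariant dense `G_δ` subset of `X`. -/
structure IsInvariantDenseGδ (G : Type*) {X : Type*} [Group G] [TopologicalSpace X]
    [MulAction G X] (C : Set X) : Prop where
  invariant : ∀ (g : G) (x : X), x ∈ C → g • x ∈ C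
  dense : Dense C
  isGδ : IsGδ C

end BeckerGame

/-! Suppose `f` reduces the orbit relation on `C` to that of an action of a CLI group `H`. Fix
neighborhoods `W n` of the identity of `H`, shrinking so fast that every product `w n * ⋯ * w 0`
with `w i ∈ W i` converges as `n` grows (`exists_nhds_tendsto_leftProd`). By category arguments some
dense `G_δ` set `K ⊆ C` has two properties: `f` is continuous on `K`, and near each point of `K`,
generic small `g` move `f c`, for `c ∈ K`, by an element of `W n`
(`exists_residual_orbit_continuity`).

The Vaught transform of `K` is an invariant dense `G_δ` set, so the hypothesis supplies `x`
embeddable into `y`, in different orbits, with generic translates in `K`. Translate both so that `x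
∈ K`. Player II can win with generic moves (`IsWinningSet.exists_generic`), giving points of `K` in
the orbit of `y` that converge to `x`, whose images move successively by elements of the `W n`. In
the limit `f x` lies in the `H`-orbit of the image of a point in the orbit of `y`, a contradiction.
-/

section

open Topology Filter Set

/-! ### Baire category: analytic sets, Kuratowski–Ulam, Vaught transforms -/

section BaireCategory

/-- The points at which a set is locally non-meagre. -/
def nonmeagreHull {X : Type*} [TopologicalSpace X] (s : Set X) : Set X :=
  {x | ∀ U, IsOpen U → x ∈ U → ¬ IsMeagre (s ∩ U)}

theorem isClosed_nonmeagreHull {X : Type*} [TopologicalSpace X] (s : Set X) :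
    IsClosed (nonmeagreHull s) := by
  rw [← isOpen_compl_iff, isOpen_iff_forall_mem_open]
  intro x hx
  simp only [nonmeagreHull, mem_compl_iff, mem_ofPred_eq, not_forall, not_not] at hx
  obtain ⟨U, hU, hxU, hm⟩ := hx
  exact ⟨U, fun y hy h => h U hU hy hm, hU, hxU⟩

theorem nonmeagreHull_subset_closure {X : Type*} [TopologicalSpace X] (s : Set X) :
    nonmeagreHull s ⊆ closure s := by
  intro x hx
  rw [mem_closure_iff]
  intro U hU hxU
  rw [inter_comm]
  exact nonempty_of_not_isMeagre (hx U hU hxU)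

theorem isMeagre_diff_nonmeagreHull {X : Type*} [TopologicalSpace X] [SecondCountableTopology X]
    (s : Set X) : IsMeagre (s \ nonmeagreHull s) := by
  have hB := TopologicalSpace.isBasis_countableBasis X
  have hc := TopologicalSpace.countable_countableBasis X
  refine (isMeagre_biUnion (I := {U ∈ TopologicalSpace.countableBasis X | IsMeagre (s ∩ U)})
    (hc.mono fun U h => h.1) (f := fun U => s ∩ U) (fun U h => h.2)).mono ?_
  rintro x ⟨hxs, hx⟩
  simp only [nonmeagreHull, mem_ofPred_eq, not_forall, not_not] at hx
  obtain ⟨U, hU, hxU, hm⟩ := hx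
  obtain ⟨V, hV, hxV, hVU⟩ := hB.exists_subset_of_mem_open hxU hU
  simp only [mem_iUnion]
  exact ⟨V, ⟨hV, hm.mono (inter_subset_inter_right _ hVU)⟩, hxs, hxV⟩

/-- If a set is covered by countably many sets, its hull is covered by theirs up to a meagre
set. -/
theorem isMeagre_nonmeagreHull_diff_iUnion {X : Type*} [TopologicalSpace X]
    [SecondCountableTopology X] (s : Set X) (t : ℕ → Set X) (h : s ⊆ ⋃ n, t n) :
    IsMeagre (nonmeagreHull s \ ⋃ n, nonmeagreHull (t n)) := by
  have hM : BaireMeasurableSet (nonmeagreHull s \ ⋃ n, nonmeagreHull (t n)) :=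
    (isClosed_nonmeagreHull s).isOpen_compl.baireMeasurableSet.of_compl.diff
      (.iUnion fun n => (isClosed_nonmeagreHull (t n)).isOpen_compl.baireMeasurableSet.of_compl)
  obtain ⟨U, hU, hMU⟩ := hM.residualEq_isOpen
  rw [eventuallyEq_set] at hMU
  -- Modulo a meagre set, `U` misses every hull of `t n`, hence every `t n`, so `s ∩ U` is meagre.
  have hdisj : ∀ x ∈ U, x ∉ nonmeagreHull s := by
    intro x hxU hx
    refine hx U hU hxU ?_
    have h1 : IsMeagre (⋃ n, t n \ nonmeagreHull (t n)) :=
      isMeagre_iUnion fun n => isMeagre_diff_nonmeagreHull (t n)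
    unfold IsMeagre at h1 ⊢
    filter_upwards [h1, hMU] with y hy hyU
    rintro ⟨hys, hyU'⟩
    have hy2 := hyU.2 hyU'
    obtain ⟨n, hn⟩ := mem_iUnion.1 (h hys)
    exact hy (mem_iUnion.2 ⟨n, hn, fun hh => hy2.2 (mem_iUnion.2 ⟨n, hh⟩)⟩)
  unfold IsMeagre
  filter_upwards [hMU] with y hy hyM
  exact hdisj y (hy.1 hyM) hyM.1

/-- Analytic sets have the property of Baire. -/
theorem MeasureTheory.AnalyticSet.baireMeasurableSet {X : Type*} [TopologicalSpace X]
    [SecondCountableTopology X] [T2Space X] {s : Set X} (hs : MeasureTheory.AnalyticSet s) :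
    BaireMeasurableSet s := by
  rw [MeasureTheory.AnalyticSet] at hs
  rcases hs with rfl | ⟨f, hf, rfl⟩
  · exact isOpen_empty.baireMeasurableSet
  -- Images of cylinders; `PiNat.res` lists the latest coordinate first, so extending a node is `n
  -- :: l`.
  let A : List ℕ → Set X := fun l => f '' {b | PiNat.res b l.length = l}
  have hA0 : A [] = range f := by simp [A]
  have hA : ∀ l, A l ⊆ ⋃ n, A (n :: l) := by
    rintro l _ ⟨b, hb, rfl⟩
    refine mem_iUnion.2 ⟨b l.length, b, ?_, rfl⟩
    simp only [mem_ofPred_eq, List.length_cons, PiNat.res_succ] at hb ⊢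
    rw [hb]
  have h1 : IsMeagre (⋃ l, nonmeagreHull (A l) \ ⋃ n, nonmeagreHull (A (n :: l))) :=
    isMeagre_iUnion fun l => isMeagre_nonmeagreHull_diff_iUnion _ _ (hA l)
  have h2 := isMeagre_diff_nonmeagreHull (A [])
  refine (isClosed_nonmeagreHull (A [])).isOpen_compl.baireMeasurableSet.of_compl.congr ?_
  rw [eventuallyEq_set]
  unfold IsMeagre at h1 h2
  filter_upwards [h1, h2] with x hx1 hx2
  rw [← hA0]
  constructor
  · intro hx
    -- Off one meagre set, membership in a hull passes to some child node. The resulting branch `b`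
    -- satisfies `f b = x` by continuity.
    have step : ∀ l : {l : List ℕ // x ∈ nonmeagreHull (A l)},
        ∃ n, x ∈ nonmeagreHull (A (n :: l.1)) := by
      rintro ⟨l, hl⟩
      by_contra hcon
      exact hx1 (mem_iUnion.2 ⟨l, hl, fun hh => hcon (mem_iUnion.1 hh)⟩)
    choose c hc using step
    let L : ℕ → {l : List ℕ // x ∈ nonmeagreHull (A l)} := fun k =>
      Nat.rec ⟨[], hx⟩ (fun _ l => ⟨c l :: l.1, hc l⟩) k
    let b : ℕ → ℕ := fun k => c (L k)
    have hL : ∀ k, (L k).1 = PiNat.res b k := by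
      intro k
      induction k with
      | zero => rfl
      | succ k ih =>
        rw [PiNat.res_succ, ← ih]
    have hfb : f b = x := by
      by_contra hne
      obtain ⟨U, V, hU, hV, hbU, hxV, hUV⟩ := t2_separation hne
      have hn : f ⁻¹' U ∈ 𝓝 b := (hU.preimage hf).mem_nhds hbU
      obtain ⟨_, ⟨y, k, rfl⟩, hby, hsub⟩ :=
        (PiNat.isTopologicalBasis_cylinders (E := fun _ => ℕ)).mem_nhds_iff.1 hn
      have hcyl := PiNat.mem_cylinder_iff_eq.1 hby
      have hx' := nonmeagreHull_subset_closure _ (L k).2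
      rw [hL, mem_closure_iff] at hx'
      obtain ⟨_, hzV, b', hb', rfl⟩ := hx' V hV hxV
      simp only [mem_ofPred_eq, PiNat.res_length] at hb'
      have : b' ∈ PiNat.cylinder b k := by
        rw [PiNat.cylinder_eq_res]
        exact hb'
      rw [hcyl] at this
      exact disjoint_left.1 hUV (hsub this) hzV
    rw [hA0]
    exact ⟨b, hfb⟩
  · intro hx
    by_contra hcon
    exact hx2 ⟨hx, hcon⟩

/-- Kuratowski–Ulam, one direction. -/
theorem eventually_residual_prod {X G : Type*} [TopologicalSpace X] [TopologicalSpace G]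
    [SecondCountableTopology G] {p : X × G → Prop} (h : ∀ᶠ q in residual (X × G), p q) :
    ∀ᶠ x in residual X, ∀ᶠ g in residual G, p (x, g) := by
  have key : ∀ O : Set (X × G), IsOpen O → Dense O →
      ∀ᶠ x in residual X, ∀ᶠ g in residual G, (x, g) ∈ O := by
    intro O hO hd
    have hB := TopologicalSpace.isBasis_countableBasis G
    have hc := TopologicalSpace.countable_countableBasis G
    have : ∀ V ∈ TopologicalSpace.countableBasis G,
        ∀ᶠ x in residual X, ∃ g ∈ V, (x, g) ∈ O := by
      intro V hV
      have hVo := hB.isOpen hV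
      have hVn := TopologicalSpace.nonempty_of_mem_countableBasis hV
      have heq : {x : X | ∃ g ∈ V, (x, g) ∈ O} = Prod.fst '' (O ∩ univ ×ˢ V) := by
        ext x; simp [and_comm]
      change {x : X | ∃ g ∈ V, (x, g) ∈ O} ∈ residual X
      refine residual_of_dense_open ?_ ?_
      · rw [heq]
        exact isOpenMap_fst _ (hO.inter (isOpen_univ.prod hVo))
      · rw [dense_iff_inter_open]
        rintro U hU ⟨u, hu⟩
        obtain ⟨v, hv⟩ := hVn
        obtain ⟨⟨a, b⟩, ⟨ha, hb⟩, hab⟩ :=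
          hd.inter_open_nonempty _ (hU.prod hVo) ⟨(u, v), hu, hv⟩
        exact ⟨a, ha, b, hb, hab⟩
    have h' := (eventually_countable_ball hc (p := fun x V _ => ∃ g ∈ V, (x, g) ∈ O)).2 this
    filter_upwards [h'] with x hx
    refine residual_of_dense_open (hO.preimage (by fun_prop : Continuous fun g => (x, g))) ?_
    rw [hB.dense_iff]
    rintro V hV -
    obtain ⟨g, hg, hgO⟩ := hx V hV
    exact ⟨g, hg, hgO⟩
  obtain ⟨S, hSo, hSd, hSc, hS⟩ := mem_residual_iff.1 h
  have h1 := (eventually_countable_ball hSc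
    (p := fun x O _ => ∀ᶠ g in residual G, (x, g) ∈ O)).2 fun O hO => key O (hSo O hO) (hSd O hO)
  filter_upwards [h1] with x hx
  have h2 := (eventually_countable_ball hSc (p := fun g O _ => (x, g) ∈ O)).2 hx
  filter_upwards [h2] with g hg
  exact hS fun O hO => hg O hO

theorem eventually_residual_mul_right {G : Type*} [Group G] [TopologicalSpace G]
    [ContinuousMul G] (a : G) {p : G → Prop} (h : ∀ᶠ g in residual G, p g) :
    ∀ᶠ g in residual G, p (g * a) :=
  (tendsto_residual_of_isOpenMap (Homeomorph.mulRight a).continuous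
    (Homeomorph.mulRight a).isOpenMap).eventually h

/-- The action map is a projection after a homeomorphism of `X × G`, so it pulls comeagre sets back
to comeagre sets, and Kuratowski–Ulam applies. -/
theorem eventually_residual_smul {G X : Type*} [Group G] [TopologicalSpace G]
    [IsTopologicalGroup G] [SecondCountableTopology G] [TopologicalSpace X] [MulAction G X]
    [ContinuousSMul G X] {p : X → Prop} (h : ∀ᶠ x in residual X, p x) :
    ∀ᶠ x in residual X, ∀ᶠ g in residual G, p (g • x) := by
  let e : X × G ≃ₜ X × G :=
    { toFun := fun q => (q.2 • q.1, q.2)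
      invFun := fun q => (q.2⁻¹ • q.1, q.2)
      left_inv := fun q => by simp
      right_inv := fun q => by simp
      continuous_toFun := by fun_prop
      continuous_invFun := by fun_prop }
  have h1 : Tendsto (fun q : X × G => q.2 • q.1) (residual (X × G)) (residual X) :=
    tendsto_residual_of_isOpenMap (by fun_prop) (isOpenMap_fst.comp e.isOpenMap)
  exact eventually_residual_prod (p := fun q : X × G => p (q.2 • q.1)) (h1.eventually h)

/-- A property holding generically holds at some point of each nonempty open set. -/
theorem exists_mem_of_eventually_residual {X : Type*} [TopologicalSpace X] [BaireSpace X]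
    {p : X → Prop} (h : ∀ᶠ x in residual X, p x) {U : Set X} (hU : IsOpen U) (hne : U.Nonempty) :
    ∃ x ∈ U, p x :=
  (dense_of_mem_residual h).inter_open_nonempty U hU hne

/-- The Vaught transform of a dense `G_δ` set is an invariant dense `G_δ` set. -/
theorem isInvariantDenseGδ_eventually_smul_mem {G X : Type*} [Group G] [TopologicalSpace G]
    [IsTopologicalGroup G] [SecondCountableTopology G] [BaireSpace G] [TopologicalSpace X]
    [BaireSpace X] [MulAction G X] [ContinuousSMul G X] {C : Set X} (hC : IsGδ C) (hd : Dense C) :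
    BeckerGame.IsInvariantDenseGδ G {x : X | ∀ᶠ g in residual G, g • x ∈ C} where
  invariant := by
    intro g x hx
    have := eventually_residual_mul_right g hx
    simpa only [mem_ofPred_eq, mul_smul] using this
  dense := dense_of_mem_residual (eventually_residual_smul (residual_of_dense_Gδ hC hd))
  isGδ := by
    obtain ⟨O, hO, rfl⟩ := isGδ_iff_eq_iInter_nat.1 hC
    have hB := TopologicalSpace.isBasis_countableBasis G
    have hc := TopologicalSpace.countable_countableBasis G
    have heq : {x : X | ∀ᶠ g in residual G, g • x ∈ ⋂ n, O n} =
        ⋂ n, ⋂ V ∈ TopologicalSpace.countableBasis G, ⋃ g ∈ V, (fun x => g • x) ⁻¹' O n := by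
      ext x
      simp only [mem_ofPred_eq, mem_iInter, eventually_countable_forall, mem_iUnion, mem_preimage,
        exists_prop]
      refine forall_congr' fun n => ⟨fun h V hV => ?_, fun h => ?_⟩
      · exact exists_mem_of_eventually_residual h (hB.isOpen hV)
          (TopologicalSpace.nonempty_of_mem_countableBasis hV)
      · refine residual_of_dense_open
          ((hO n).preimage (by fun_prop : Continuous fun g : G => g • x)) ?_
        rw [hB.dense_iff]
        rintro V hV -
        exact h V hV
    rw [heq]
    refine IsGδ.iInter fun n => IsGδ.biInter_of_isOpen hc fun V _ => ?_
    exact isOpen_biUnion fun g _ => (hO n).preimage (continuous_const_smul g)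

end BaireCategory

/-! ### Generic continuity of Borel homomorphisms of orbit relations -/

section OrbitContinuity

/-- The property of Baire for sets defined by quantifying over group elements. -/
theorem baireMeasurableSet_exists_smul_eq {Z H Y : Type*} [TopologicalSpace Z] [PolishSpace Z]
    [MeasurableSpace Z] [BorelSpace Z] [Group H] [TopologicalSpace H] [PolishSpace H]
    [TopologicalSpace Y] [PolishSpace Y] [MeasurableSpace Y] [BorelSpace Y]
    [MulAction H Y] [ContinuousSMul H Y] {φ ψ : Z → Y} (hφ : Measurable φ) (hψ : Measurable ψ)
    {W : Set H} (hW : IsOpen W) : BaireMeasurableSet {z : Z | ∃ w ∈ W, φ z = w • ψ z} := by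
  borelize H
  have hmeas : MeasurableSet {t : Z × H | t.2 ∈ W ∧ φ t.1 = t.2 • ψ t.1} := by
    refine (hW.measurableSet.preimage measurable_snd).inter (measurableSet_eq_fun ?_ ?_)
    · exact hφ.comp measurable_fst
    · have : Measurable fun p : H × Y => p.1 • p.2 := continuous_smul.measurable
      exact this.comp (measurable_snd.prodMk (hψ.comp measurable_fst))
  convert (hmeas.analyticSet.image_of_continuous continuous_fst).baireMeasurableSet using 1
  ext z
  simp

/-- A Borel map is continuous on a comeagre set. -/
theorem Measurable.exists_residual_continuousOn {X Y : Type*} [TopologicalSpace X]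
    [MeasurableSpace X] [BorelSpace X] [TopologicalSpace Y] [SecondCountableTopology Y]
    [MeasurableSpace Y] [BorelSpace Y] {f : X → Y} (hf : Measurable f) :
    ∃ D ∈ residual X, ContinuousOn f D := by
  have hB := TopologicalSpace.isBasis_countableBasis Y
  have hc := TopologicalSpace.countable_countableBasis Y
  have h1 : ∀ V ∈ TopologicalSpace.countableBasis Y,
      ∃ O : Set X, IsOpen O ∧ ∀ᶠ x in residual X, (f x ∈ V ↔ x ∈ O) := by
    intro V hV
    obtain ⟨O, hO, h⟩ := (hf (hB.isOpen hV).measurableSet).residualEq_isOpen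
    exact ⟨O, hO, eventuallyEq_set.1 h⟩
  choose! O hO hfO using h1
  refine ⟨_, (eventually_countable_ball hc (p := fun x V _ => f x ∈ V ↔ x ∈ O V)).2 hfO, ?_⟩
  intro x hx
  rw [ContinuousWithinAt, hB.nhds_hasBasis.tendsto_right_iff]
  rintro V ⟨hV, hxV⟩
  filter_upwards [self_mem_nhdsWithin,
    mem_nhdsWithin_of_mem_nhds ((hO V hV).mem_nhds ((hx V hV).1 hxV))] with y hy hyO
  exact (hy V hV).2 hyO

variable {G : Type*} {X : Type*} {H : Type*} {Y : Type*} [Group G] [TopologicalSpace G]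
  [IsTopologicalGroup G] [PolishSpace G] [TopologicalSpace X]
  [MeasurableSpace X] [BorelSpace X] [MulAction G X] [ContinuousSMul G X]
  [Group H] [TopologicalSpace H] [IsTopologicalGroup H] [PolishSpace H]
  [TopologicalSpace Y] [PolishSpace Y] [MeasurableSpace Y] [BorelSpace Y]
  [MulAction H Y] [ContinuousSMul H Y]

/-- Along a single orbit, a Borel homomorphism to an orbit equivalence relation is generically
continuous in the sense of the acting groups. -/
theorem eventually_exists_nhds_eventually_smul {f : X → Y} (hf : Measurable f) {x : X}
    (hx : ∀ g : G, ∃ h : H, f (g • x) = h • f x) {W : Set H} (hW : W ∈ 𝓝 1) :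
    ∀ᶠ g in residual G, ∃ V ∈ 𝓝 (1 : G), ∀ᶠ g' in residual G,
      g' ∈ V → ∃ w ∈ W, f (g' • g • x) = w • f (g • x) := by
  obtain ⟨W₁, hW₁, hdiv⟩ := exists_nhds_split_inv hW
  obtain ⟨W₀, hW₀₁, hW₀, h1W₀⟩ := mem_nhds_iff.1 hW₁
  borelize G
  let d := TopologicalSpace.denseSeq H
  -- Countably many right translates of `W₀` cover `H`; two elements `h'`, `h` of one translate
  -- satisfy `h' * h⁻¹ ∈ W`.
  let T : ℕ → Set H := fun k => {h | h * (d k)⁻¹ ∈ W₀}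
  have hT : ∀ k, IsOpen (T k) := fun k => hW₀.preimage (by fun_prop)
  have hcov : ∀ h : H, ∃ k, h ∈ T k := by
    intro h
    have ho : IsOpen {k : H | h * k⁻¹ ∈ W₀} := hW₀.preimage (by fun_prop)
    exact (TopologicalSpace.denseRange_denseSeq H).exists_mem_open ho ⟨h, by simpa using h1W₀⟩
  have hmx : Measurable fun g : G => f (g • x) :=
    hf.comp (by fun_prop : Continuous fun g : G => g • x).measurable
  have hS : ∀ k, ∃ O : Set G, IsOpen O ∧
      ∀ᶠ g in residual G, ((∃ w ∈ T k, f (g • x) = w • f x) ↔ g ∈ O) := by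
    intro k
    obtain ⟨O, hO, h⟩ := (baireMeasurableSet_exists_smul_eq hmx
      (measurable_const (a := f x)) (hT k)).residualEq_isOpen
    exact ⟨O, hO, eventuallyEq_set.1 h⟩
  choose O hO hSO using hS
  have hall := eventually_countable_forall.2 hSO
  filter_upwards [hall] with g hg
  obtain ⟨h, hh⟩ := hx g
  obtain ⟨k, hk⟩ := hcov h
  have hgO : g ∈ O k := (hg k).1 ⟨h, hk, hh⟩
  refine ⟨(fun g' => g' * g) ⁻¹' O k, ?_, ?_⟩
  · exact ((hO k).preimage (by fun_prop)).mem_nhds (by simpa using hgO)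
  · filter_upwards [eventually_residual_mul_right g hall] with g' hg' hmem
    obtain ⟨h', hk', hh'⟩ := (hg' k).2 hmem
    refine ⟨h' * h⁻¹, ?_, ?_⟩
    · have := hdiv _ (hW₀₁ hk') _ (hW₀₁ hk)
      simpa [div_eq_mul_inv, mul_assoc] using this
    · rw [← mul_smul, hh', hh, mul_smul, inv_smul_smul]

/-- The set of points `x` such that generically many `g ∈ V` satisfy a relation with the property
of Baire has the property of Baire. -/
theorem baireMeasurableSet_eventually_mem {X G : Type*} [TopologicalSpace X] [TopologicalSpace G]
    [SecondCountableTopology G] [BaireSpace G] {A : Set (X × G)} (hA : BaireMeasurableSet A)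
    {V : Set G} (hV : IsOpen V) :
    BaireMeasurableSet {x : X | ∀ᶠ g in residual G, g ∈ V → (x, g) ∈ A} := by
  obtain ⟨O, hO, hAO⟩ := hA.residualEq_isOpen
  have hB := TopologicalSpace.isBasis_countableBasis G
  have hc := TopologicalSpace.countable_countableBasis G
  have hD : BaireMeasurableSet (⋂ U ∈ {U ∈ TopologicalSpace.countableBasis G | U ⊆ V},
      {x : X | ∃ g ∈ U, (x, g) ∈ O}) := by
    refine .biInter (hc.mono fun U h => h.1) fun U hU => IsOpen.baireMeasurableSet ?_
    have heq : {x : X | ∃ g ∈ U, (x, g) ∈ O} = ⋃ g ∈ U, (fun x => (x, g)) ⁻¹' O := by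
      ext; simp
    rw [heq]
    exact isOpen_biUnion fun g _ => hO.preimage (by fun_prop)
  refine hD.congr ?_
  rw [eventuallyEq_set]
  filter_upwards [eventually_residual_prod (eventuallyEq_set.1 hAO)] with x hx
  simp only [mem_iInter, mem_ofPred_eq, and_imp]
  constructor
  · intro h
    -- Adding the exterior of `V` turns density within `V` into density in `G`.
    have hdense : Dense ({g | (x, g) ∈ O} ∪ (closure V)ᶜ) := by
      rw [hB.dense_iff]
      rintro U hU ⟨u, hu⟩
      by_cases huV : u ∈ closure V
      · obtain ⟨v, hvU, hvV⟩ := mem_closure_iff.1 huV U (hB.isOpen hU) hu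
        obtain ⟨U', hU', hvU', hsub⟩ :=
          hB.exists_subset_of_mem_open (⟨hvU, hvV⟩ : v ∈ U ∩ V) ((hB.isOpen hU).inter hV)
        obtain ⟨g, hg, hgO⟩ := h U' hU' (hsub.trans inter_subset_right)
        exact ⟨g, (hsub hg).1, Or.inl hgO⟩
      · exact ⟨u, hu, Or.inr huV⟩
    have hres := residual_of_dense_open ((hO.preimage
      (by fun_prop : Continuous fun g : G => (x, g))).union isClosed_closure.isOpen_compl) hdense
    filter_upwards [hx, hres] with g hg hgr hgV
    rcases hgr with hgO | hgc
    · exact hg.2 hgO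
    · exact absurd (subset_closure hgV) hgc
  · intro h U hU hUV
    obtain ⟨g, hgU, h1, h2⟩ := exists_mem_of_eventually_residual (hx.and h) (hB.isOpen hU)
      (TopologicalSpace.nonempty_of_mem_countableBasis hU)
    exact ⟨g, hgU, h1.1 (h2 (hUV hgU))⟩

/-- The orbit continuity lemma. -/
theorem exists_residual_orbit_continuity [PolishSpace X] {f : X → Y} (hf : Measurable f)
    (hhom : ∀ᶠ x in residual X, ∀ g : G, ∃ h : H, f (g • x) = h • f x)
    {W : Set H} (hW : W ∈ 𝓝 1) :
    ∃ D ∈ residual X, ∀ x ∈ D, ∃ U ∈ 𝓝 x, ∃ V ∈ 𝓝 (1 : G), ∀ c ∈ D ∩ U,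
      ∀ᶠ g in residual G, g ∈ V → ∃ w ∈ W, f (g • c) = w • f c := by
  obtain ⟨W₀, hW₀W, hW₀, h1W₀⟩ := mem_nhds_iff.1 hW
  borelize G
  obtain ⟨V, hV⟩ := (𝓝 (1 : G)).exists_antitone_basis
  let E : ℕ → Set X := fun n => {x | ∀ᶠ g in residual G, g ∈ interior (V n) →
    ∃ w ∈ W₀, f (g • x) = w • f x}
  have hE : ∀ n, ∃ U : Set X, IsOpen U ∧ ∀ᶠ x in residual X, (x ∈ E n ↔ x ∈ U) := by
    intro n
    have hA : BaireMeasurableSet {q : X × G | ∃ w ∈ W₀, f (q.2 • q.1) = w • f q.1} :=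
      baireMeasurableSet_exists_smul_eq
        (hf.comp (by fun_prop : Continuous fun q : X × G => q.2 • q.1).measurable)
        (hf.comp measurable_fst) hW₀
    obtain ⟨U, hU, h⟩ :=
      (baireMeasurableSet_eventually_mem hA (isOpen_interior (s := V n))).residualEq_isOpen
    exact ⟨U, hU, eventuallyEq_set.1 h⟩
  choose U hU hEU using hE
  have hall := eventually_countable_forall.2 hEU
  -- By the single-orbit lemma, a generic translate of a generic point of `N` that stays in `N` lies
  -- in some `E n`.
  have hdense : Dense (⋃ n, U n) := by
    rw [dense_iff_inter_open]
    intro N hN hne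
    by_contra hemp
    obtain ⟨x, hxN, hx1, hx2⟩ :=
      exists_mem_of_eventually_residual ((eventually_residual_smul (G := G) hall).and hhom) hN hne
    have hx3 := eventually_exists_nhds_eventually_smul hf hx2 (hW₀.mem_nhds h1W₀)
    obtain ⟨g, hgN, hg1, V', hV', hg2⟩ := exists_mem_of_eventually_residual (hx1.and hx3)
      (hN.preimage (by fun_prop : Continuous fun g : G => g • x)) ⟨1, by simpa using hxN⟩
    obtain ⟨n, -, hn⟩ := hV.1.mem_iff.1 hV'
    refine hemp ⟨g • x, hgN, mem_iUnion.2 ⟨n, (hg1 n).1 ?_⟩⟩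
    filter_upwards [hg2] with g' hg' hmem
    exact hg' (hn (interior_subset hmem))
  refine ⟨{x | ∀ n, x ∈ E n ↔ x ∈ U n} ∩ ⋃ n, U n,
    inter_mem hall (residual_of_dense_open (isOpen_iUnion hU) hdense), ?_⟩
  rintro x ⟨-, hx⟩
  obtain ⟨n, hn⟩ := mem_iUnion.1 hx
  refine ⟨U n, (hU n).mem_nhds hn, interior (V n),
    isOpen_interior.mem_nhds (mem_interior_iff_mem_nhds.2 (hV.1.mem_of_mem trivial)), ?_⟩
  rintro c ⟨⟨hc, -⟩, hcU⟩
  filter_upwards [(hc n).2 hcU] with g hg hgV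
  obtain ⟨w, hw, h⟩ := hg hgV
  exact ⟨w, hW₀W hw, h⟩

end OrbitContinuity

/-! ### Winning positions, generic play and convergence in CLI groups -/

section Game

open BeckerGame

theorem leftProd_congr {G : Type*} [Group G] {g g' : ℕ → G} {n : ℕ} (h : ∀ i < n, g i = g' i) :
    leftProd g n = leftProd g' n := by
  induction n with
  | zero => rfl
  | succ n ih =>
    rw [leftProd, leftProd, h n n.lt_succ_self, ih fun i hi => h i (hi.trans n.lt_succ_self)]

/-- A set of winning positions for Player II: in position `(z, V)` the current point is `z`, and
the next move of Player II has to be in `V`. -/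
def IsWinningSet {G X : Type*} [Group G] [TopologicalSpace G] [TopologicalSpace X]
    [MulAction G X] (x : X) (P : X → Set G → Prop) : Prop :=
  ∀ z V, P z V → ∀ U ∈ 𝓝 x, ∀ V' ∈ 𝓝 (1 : G), ∃ g ∈ V, g • z ∈ U ∧ P (g • z) V'

theorem BeckerGame.BeckerEmbeddable.exists_isWinningSet {G X : Type*} [Group G]
    [TopologicalSpace G] [TopologicalSpace X] [MulAction G X] {x y : X}
    (h : BeckerEmbeddable G x y) :
    ∃ P : X → Set G → Prop, IsWinningSet x P ∧ P y univ := by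
  obtain ⟨σ, hσ⟩ := h
  -- Positions reached by `σ` after `n` turns, with `V` containing all legal replies; for `n = 0`
  -- this forces `V` to be all of `G`.
  refine ⟨fun z V => ∃ (m : ℕ → MoveI G x) (n : ℕ), z = leftProd (σ.play m) n • y ∧
    ∀ g, (∀ k, n = k + 1 → g ∈ (m k).V) → g ∈ V, ?_, ?_⟩
  · rintro z V ⟨m, n, rfl, hV⟩ U hU V' hV'
    obtain ⟨U₀, hU₀U, hU₀, hxU₀⟩ := mem_nhds_iff.1 hU
    obtain ⟨V₀, hV₀V, hV₀, h1V₀⟩ := mem_nhds_iff.1 hV'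
    let mv : MoveI G x := ⟨⟨⟨U₀, hU₀⟩, hxU₀⟩, ⟨⟨V₀, hV₀⟩, h1V₀⟩⟩
    let m' : ℕ → MoveI G x := fun i => if i < n then m i else mv
    have hm' : ∀ i < n, m' i = m i := fun i hi => if_pos hi
    have hmn : m' n = mv := if_neg (lt_irrefl n)
    have hplay : ∀ i < n, σ.play m' i = σ.play m i := by
      intro i hi
      unfold StrategyII.play
      congr 1
      funext j
      exact hm' j (by omega)
    have hprod : leftProd (σ.play m') (n + 1) • y =
        σ.play m' n • leftProd (σ.play m) n • y := by
      rw [leftProd, mul_smul, leftProd_congr hplay]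
    obtain ⟨hw1, hw2⟩ := hσ m'
    refine ⟨σ.play m' n, hV _ ?_, ?_, m', n + 1, hprod.symm, ?_⟩
    · rintro k rfl
      rw [← hm' k k.lt_succ_self]
      exact hw1 k
    · have := hw2 n
      rw [hprod, hmn] at this
      exact hU₀U this
    · intro g hg
      have := hg n rfl
      rw [hmn] at this
      exact hV₀V this
  · rcases isEmpty_or_nonempty (ℕ → MoveI G x) with he | ⟨⟨m⟩⟩
    · exact (he.false fun _ => ⟨⊤, ⊤⟩).elim
    · exact ⟨m, 0, by simp [leftProd], fun g _ => mem_univ g⟩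

/-- Conjugating Player II's moves by `a` transports the game, so `x` may be replaced by a translate
lying in a given comeagre set. -/
theorem IsWinningSet.smul {G X : Type*} [Group G] [TopologicalSpace G] [IsTopologicalGroup G]
    [TopologicalSpace X] [MulAction G X] [ContinuousConstSMul G X] {x : X}
    {P : X → Set G → Prop} (hP : IsWinningSet x P) (a : G) :
    IsWinningSet (a • x) fun z V => P (a⁻¹ • z) ((fun g => a * g * a⁻¹) ⁻¹' V) := by
  intro z V hz U hU V' hV'
  have hV'' : (fun g => a * g * a⁻¹) ⁻¹' V' ∈ 𝓝 (1 : G) := by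
    refine (by fun_prop : Continuous fun g : G => a * g * a⁻¹).continuousAt.preimage_mem_nhds ?_
    simpa using hV'
  obtain ⟨g, hg, hgU, hgP⟩ := hP _ _ hz _
    ((continuous_const_smul a).continuousAt.preimage_mem_nhds hU) _ hV''
  refine ⟨a * g * a⁻¹, hg, ?_, ?_⟩
  · simpa [mul_smul] using hgU
  · simpa [mul_smul] using hgP

/-- Player II can moreover choose the elements generically. -/
theorem IsWinningSet.exists_generic {G X : Type*} [Group G] [TopologicalSpace G]
    [IsTopologicalGroup G] [BaireSpace G] [TopologicalSpace X] [MulAction G X]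
    [ContinuousSMul G X] {x y : X} {P : X → Set G → Prop} (hP : IsWinningSet x P)
    (hy : P y univ) :
    ∃ Q : X → Set G → Prop, Q y univ ∧ ∀ z V, Q z V → ∀ U ∈ 𝓝 x, ∀ V' ∈ 𝓝 (1 : G),
      ∀ p : G → Prop, (∀ᶠ g in residual G, p g) →
        ∃ g ∈ V, p g ∧ g • z ∈ U ∧ Q (g • z) V' := by
  -- The actual point `z` differs from the strategic point `z'` by an error `e`, so small that each
  -- reply `g ∈ V₀` can be corrected to `g * e⁻¹` with room to spare in `V`. A generic `a` near `1`
  -- then gives the reply `a * (g * e⁻¹)` and becomes the new error.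
  refine ⟨fun z V => ∃ (z' : X) (V₀ : Set G) (e : G), P z' V₀ ∧ z = e • z' ∧
    ∀ g ∈ V₀, V ∈ 𝓝 (g * e⁻¹), ⟨y, univ, 1, hy, by simp, fun _ _ => univ_mem⟩, ?_⟩
  rintro _ V ⟨z, V₀, e, hz, rfl, hV⟩ U hU V' hV' p hp
  obtain ⟨S, hS, hdiv⟩ := exists_nhds_split_inv (interior_mem_nhds.2 hV')
  obtain ⟨g, hg, hgU, hgP⟩ := hP z V₀ hz (interior U) (interior_mem_nhds.2 hU) S hS
  have hN : IsOpen {a : G | a ∈ interior S ∧ a • g • z ∈ interior U ∧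
      a * (g * e⁻¹) ∈ interior V} :=
    isOpen_interior.inter ((isOpen_interior.preimage (by fun_prop)).inter
      (isOpen_interior.preimage (by fun_prop)))
  obtain ⟨a, ⟨haS, haU, haV⟩, hpa⟩ := exists_mem_of_eventually_residual
    (eventually_residual_mul_right (g * e⁻¹) hp) hN
    ⟨1, mem_interior_iff_mem_nhds.2 hS, by simpa using hgU,
      by simpa using mem_interior_iff_mem_nhds.2 (hV g hg)⟩
  have heq : (a * (g * e⁻¹)) • e • z = a • g • z := by simp [mul_smul]
  refine ⟨a * (g * e⁻¹), interior_subset haV, hpa, ?_, g • z, S, a, hgP, heq, ?_⟩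
  · rw [heq]
    exact interior_subset haU
  · intro b hb
    rw [← div_eq_mul_inv]
    exact mem_interior_iff_mem_nhds.1 (hdiv b hb a (interior_subset haS))

/-- In a CLI group, left products of sufficiently small elements converge. -/
theorem BeckerGame.IsCLIGroup.exists_nhds_tendsto_leftProd {H : Type*} [Group H]
    [t : TopologicalSpace H] (hH : IsCLIGroup H) :
    ∃ W : ℕ → Set H, (∀ n, W n ∈ 𝓝 1) ∧ ∀ w : ℕ → H, (∀ n, w n ∈ W n) →
      ∃ h, Tendsto (leftProd w) atTop (𝓝 h) := by
  have := hH.isTopologicalGroup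
  obtain ⟨d, rfl, hcomp, hinv⟩ := hH.exists_metric
  refine ⟨fun n => {w | dist w⁻¹ 1 < (1 / 2) ^ n}, fun n => ?_, fun w hw => ?_⟩
  · refine IsOpen.mem_nhds ?_ (by simp)
    exact isOpen_lt (by fun_prop) continuous_const
  -- Inverting turns left factors into right factors, so left invariance bounds the `n`-th step by
  -- `dist (w n)⁻¹ 1`.
  · have hc : CauchySeq fun n => (leftProd w n)⁻¹ := by
      refine cauchySeq_of_le_geometric (1 / 2) 1 (by norm_num) fun n => ?_
      have h1 := hinv (leftProd w n)⁻¹ 1 (w n)⁻¹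
      rw [mul_one] at h1
      rw [leftProd, mul_inv_rev, one_mul]
      refine h1.trans_le ?_
      rw [dist_comm]
      exact (hw n).le
    obtain ⟨q, hq⟩ := cauchySeq_tendsto_of_complete hc
    exact ⟨q⁻¹, by simpa using hq.inv⟩

/-- Following a generic winning strategy of Player II at a point of generic orbit continuity shows
that the images are in the same orbit. -/
theorem exists_smul_eq_of_generic_winning {G X H Y : Type*} [Group G] [TopologicalSpace G]
    [TopologicalSpace X] [FirstCountableTopology X] [MulAction G X]
    [Group H] [TopologicalSpace H] [TopologicalSpace Y] [T2Space Y]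
    [MulAction H Y] [ContinuousSMul H Y] {f : X → Y} {W : ℕ → Set H}
    (hW : ∀ w : ℕ → H, (∀ n, w n ∈ W n) → ∃ h, Tendsto (leftProd w) atTop (𝓝 h))
    {D : Set X} {x y : X} (hfx : ContinuousWithinAt f D x)
    (hyD : ∀ g : G, ∀ᶠ g' in residual G, g' • g • y ∈ D)
    (hD : ∀ n, ∃ U ∈ 𝓝 x, ∃ V ∈ 𝓝 (1 : G), ∀ c ∈ D ∩ U,
      ∀ᶠ g in residual G, g ∈ V → ∃ w ∈ W n, f (g • c) = w • f c)
    {Q : X → Set G → Prop} (hy : Q y univ)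
    (hQ : ∀ z V, Q z V → ∀ U ∈ 𝓝 x, ∀ V' ∈ 𝓝 (1 : G),
      ∀ p : G → Prop, (∀ᶠ g in residual G, p g) →
        ∃ g ∈ V, p g ∧ g • z ∈ U ∧ Q (g • z) V') :
    ∃ (g : G) (h : H), g • y ∈ D ∧ f x = h • f (g • y) := by
  choose U hU V hV hUV using hD
  obtain ⟨B, hB⟩ := (𝓝 x).exists_antitone_basis
  -- At stage `n`, Player I has played inside `U n` for orbit continuity and inside `B n` for
  -- convergence to `x`; `V n` constrains the next reply.
  let S : ℕ → Type _ := fun n =>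
    {g : G // g • y ∈ D ∧ g • y ∈ U n ∩ B n ∧ Q (g • y) (V n)}
  have h0 : Nonempty (S 0) := by
    obtain ⟨g, -, hg, hgU, hgQ⟩ := hQ y univ hy (U 0 ∩ B 0)
      (inter_mem (hU 0) (hB.1.mem_of_mem trivial)) (V 0) (hV 0) (fun g => g • y ∈ D)
      (by simpa using hyD 1)
    exact ⟨g, hg, hgU, hgQ⟩
  have hstep : ∀ n (s : S n), ∃ s' : S (n + 1), ∃ w ∈ W n, f (s'.1 • y) = w • f (s.1 • y) := by
    rintro n ⟨g, hg, hgU, hgQ⟩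
    obtain ⟨g', hg'V, ⟨hp1, hp2⟩, hg'U, hg'Q⟩ := hQ _ _ hgQ (U (n + 1) ∩ B (n + 1))
      (inter_mem (hU _) (hB.1.mem_of_mem trivial)) (V (n + 1)) (hV _) _
      ((hyD g).and (hUV n _ ⟨hg, hgU.1⟩))
    rw [← mul_smul] at hp1 hg'U hg'Q hp2
    exact ⟨⟨g' * g, hp1, hg'U, hg'Q⟩, hp2 hg'V⟩
  choose next w hw hnext using hstep
  let s : ∀ n, S n := fun n => Nat.rec h0.some (fun n s => next n s) n
  obtain ⟨h, hh⟩ := hW (fun n => w n (s n)) fun n => hw n (s n)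
  have hprod : ∀ n, f ((s n).1 • y) =
      leftProd (fun n => w n (s n)) n • f ((s 0).1 • y) := by
    intro n
    induction n with
    | zero => simp [leftProd]
    | succ n ih =>
      rw [leftProd, mul_smul, ← ih]
      exact hnext n (s n)
  have hz : Tendsto (fun n => (s n).1 • y) atTop (𝓝[D] x) :=
    tendsto_nhdsWithin_iff.2 ⟨hB.tendsto fun n => (s n).2.2.1.2,
      Eventually.of_forall fun n => (s n).2.1⟩
  have hlim1 := hfx.tendsto.comp hz
  have hlim2 : Tendsto (fun n => leftProd (fun n => w n (s n)) n • f ((s 0).1 • y)) atTop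
      (𝓝 (h • f ((s 0).1 • y))) := hh.smul_const _
  refine ⟨(s 0).1, h, (s 0).2.1, tendsto_nhds_unique (hlim1.congr fun n => hprod n) hlim2⟩

end Game

end

/-! ### The main theorem -/

open Topology Filter Set in
theorem mainTheorem1 {G : Type z} {X : Type u}
    [Group G] [TopologicalSpace G] [IsTopologicalGroup G] [PolishSpace G]
    [TopologicalSpace X] [PolishSpace X] [MulAction G X] [ContinuousSMul G X]
    (hX : ∀ C : Set X, BeckerGame.IsInvariantDenseGδ G C →
      ∃ x ∈ C, ∃ y ∈ C, ¬ MulAction.orbitRel G X x y ∧ BeckerGame.BeckerEmbeddable G x y) :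
    ∀ C : Set X, BeckerGame.IsInvariantDenseGδ G C →
      ¬ BeckerGame.CLIClassifiable.{u, v, w} (BeckerGame.orbitRelOn G C) := by
  classical
  rintro C hC ⟨H, Y, _, _, _, _, hH, _, _, f₀, hf₀, hred⟩
  have := hH.isTopologicalGroup
  have := hH.polishSpace
  borelize X Y
  have hf₁ : Measurable f₀ := by
    convert hf₀ using 1
    exact BorelSpace.measurable_eq
  obtain ⟨x₀, hx₀, -⟩ := hX C hC
  -- The value off `C` is irrelevant, since `C` is invariant and comeagre.
  let f : X → Y := fun x => if h : x ∈ C then f₀ ⟨x, h⟩ else f₀ ⟨x₀, hx₀⟩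
  have hfC : ∀ x (h : x ∈ C), f x = f₀ ⟨x, h⟩ := fun x h => dif_pos h
  have hf : Measurable f := Measurable.dite hf₁ measurable_const hC.isGδ.measurableSet
  have hrel : ∀ a ∈ C, ∀ b ∈ C,
      MulAction.orbitRel G X a b ↔ MulAction.orbitRel H Y (f a) (f b) := by
    intro a ha b hb
    rw [hfC a ha, hfC b hb]
    exact hred ⟨a, ha⟩ ⟨b, hb⟩
  have hCres := residual_of_dense_Gδ hC.isGδ hC.dense
  have hhom : ∀ᶠ x in residual X, ∀ g : G, ∃ h : H, f (g • x) = h • f x := by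
    filter_upwards [hCres] with x hx g
    obtain ⟨h, hh⟩ := (hrel _ (hC.invariant g x hx) x hx).1 ⟨g, rfl⟩
    exact ⟨h, hh.symm⟩
  obtain ⟨W, hW1, hW⟩ := hH.exists_nhds_tendsto_leftProd
  choose D hD hDW using fun n => exists_residual_orbit_continuity hf hhom (hW1 n)
  obtain ⟨D', hD', hfD'⟩ := hf.exists_residual_continuousOn
  obtain ⟨K, hK, hKδ, hKd⟩ := mem_residual.1
    (inter_mem hCres (inter_mem hD' (countable_iInter_mem.2 hD)))
  obtain ⟨x, hx, y, hy, hxy, hemb⟩ := hX _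
    (isInvariantDenseGδ_eventually_smul_mem (G := G) hKδ hKd)
  obtain ⟨a, -, ha⟩ := exists_mem_of_eventually_residual hx isOpen_univ univ_nonempty
  obtain ⟨P, hP, hPy⟩ := hemb.exists_isWinningSet
  obtain ⟨Q, hQy, hQ⟩ := (hP.smul a).exists_generic (y := a • y) (by simpa using hPy)
  have hyK : ∀ g : G, ∀ᶠ g' in residual G, g' • g • a • y ∈ K := by
    intro g
    simpa only [mul_smul] using eventually_residual_mul_right (g * a) hy
  obtain ⟨g, h, hg, hfg⟩ := exists_smul_eq_of_generic_winning hW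
    ((hfD' _ (hK ha).2.1).mono fun z hz => (hK hz).2.1) hyK (fun n => by
      obtain ⟨U, hU, V, hV, hUV⟩ := hDW n _ (mem_iInter.1 (hK ha).2.2 n)
      exact ⟨U, hU, V, hV, fun c hc => hUV c ⟨mem_iInter.1 (hK hc.1).2.2 n, hc.2⟩⟩) hQy hQ
  obtain ⟨b, hb⟩ := (hrel _ (hK ha).1 _ (hK hg).1).2 ⟨h, hfg.symm⟩
  refine hxy ⟨a⁻¹ * b * g * a, ?_⟩
  simpa [mul_smul, inv_smul_eq_iff] using hb
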